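/- Let $K$ be a field of characteristic zero, let $n\ge 0$, and let $H=(H_1,\dots,H_n)\in K[x_1,\dots,x_n]^n$. For a polynomial map $P=(P_1,\dots,P_n)$ write $\mathcal{J}P=\big(\partial P_i/\partial x_j\big)_{i,j}$ for its Jacobian matrix. Suppose that $F=x+H$ is a Keller map, that is, $\det \mathcal{J}F\in K^*=K\setminus\{0\}$, and that $\operatorname{rk}\mathcal{J}H=1$, the rank being taken over the field of rational functions $K(x_1,\dots,x_n)$. Then $F$ is invertible, i.e. there is $G\in K[x_1,\dots,x_n]^n$ with $F(G(x))=x=G(F(x))$. Moreover, $F$ is tame: it is a finite composition of invertible affine maps $x\mapsto Ax+b$ ($A\in \mathrm{GL}_n(K)$, $b\in K^n$) and elementary maps, which replace one coordinate $x_i$ by $x_i+q$, with $q$ a polynomial in the variables $x_j$, $j\neq i$, and fix all other coordinates. Finally, for the statements (1) $H$ has no linear terms, i.e. no $H_i$ contains a term of degree exactly one; (2) $\det\mathcal{J}F=1$; (3) $\mathcal{J}H\cdot\mathcal{J}H|_{x=y}=0$, where $y=(y_1,\dots,y_n)$ are further independent variables and the product is taken over $K[x_1,\dots,x_n,y_1,\dots,y_n]$;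 the implications (1) $\Rightarrow$ (2) $\Rightarrow$ (3) hold. -/

import Mathlib

noncomputable section

/-- A polynomial map in dimension `n` over `K`, given by its `n` components in
`K[x₁, …, xₙ]`. -/
abbrev PolyMap (n : ℕ) (K : Type*) [CommSemiring K] : Type _ :=
  Fin n → MvPolynomial (Fin n) K

namespace PolyMap

variable {n : ℕ} {K : Type*} [Field K]

/-- The identity map `x = (x₁, …, xₙ)`. -/
def ident (n : ℕ) (K : Type*) [Field K] : PolyMap n K := fun i => MvPolynomial.X i

/-- The composition `F ∘ G`, that is, `F(G(x))`. -/
def comp (F G : PolyMap n K) : PolyMap n K := fun i => MvPolynomial.bind₁ G (F i)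

/-- The Jacobian matrix, with entry `∂ Fᵢ / ∂ xⱼ` in row `i` and column `j`. -/
def jacobian (F : PolyMap n K) : Matrix (Fin n) (Fin n) (MvPolynomial (Fin n) K) :=
  Matrix.of fun i j => MvPolynomial.pderiv j (F i)

/-- The rank of a matrix of polynomials: its rank over the field of fractions `K(x)`. -/
def polyRank (M : Matrix (Fin n) (Fin n) (MvPolynomial (Fin n) K)) : ℕ :=
  (M.map (algebraMap (MvPolynomial (Fin n) K)
    (FractionRing (MvPolynomial (Fin n) K)))).rank

/-- A Keller map: the Jacobian determinant is a nonzero constant. -/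
def IsKeller (F : PolyMap n K) : Prop :=
  ∃ c : K, c ≠ 0 ∧ F.jacobian.det = MvPolynomial.C c

/-- Invertibility: there is a two-sided polynomial inverse. -/
def IsInvertible (F : PolyMap n K) : Prop :=
  ∃ G : PolyMap n K, F.comp G = ident n K ∧ G.comp F = ident n K

/-- An invertible affine map `x ↦ A x + b` with `A ∈ GLₙ(K)` and `b ∈ Kⁿ`. -/
def IsAffine (F : PolyMap n K) : Prop :=
  ∃ (A : GL (Fin n) K) (b : Fin n → K), ∀ i,
    F i = ∑ j, MvPolynomial.C (A.val i j) * MvPolynomial.X j + MvPolynomial.C (b i)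

/-- An elementary map: it replaces one coordinate `xᵢ` by `xᵢ + q`, where `q` is a polynomial
in the other variables, and fixes all the other coordinates. -/
def IsElementary (F : PolyMap n K) : Prop :=
  ∃ (i : Fin n) (q : MvPolynomial (Fin n) K), i ∉ q.vars ∧
    F = Function.update (ident n K) i (MvPolynomial.X i + q)

/-- Tame maps: the finite compositions of invertible affine maps and elementary maps.
(Inverses of generators are again generators, so this is the tame subgroup.) -/
inductive IsTame : PolyMap n K → Prop
  | affine {F : PolyMap n K} (hF : IsAffine F) : IsTame F
  | elementary {F : PolyMap n K} (hF : IsElementary F) : IsTame F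
  | comp {F G : PolyMap n K} (hF : IsTame F) (hG : IsTame G) : IsTame (PolyMap.comp F G)

/-- No component of `H` has a term of degree exactly one. -/
def NoLinearTerms (H : PolyMap n K) : Prop :=
  ∀ i j, MvPolynomial.coeff (Finsupp.single j 1) (H i) = 0

/-- The identity `JH(x) · JH(y) = 0` over `K[x, y]`, where the variables `x` are indexed by the
left summand and the variables `y` by the right summand of `Fin n ⊕ Fin n`. -/
def JacobianProductVanishes (H : PolyMap n K) : Prop :=
  (H.jacobian.map (MvPolynomial.rename (Sum.inl : Fin n → Fin n ⊕ Fin n))) *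
    (H.jacobian.map (MvPolynomial.rename (Sum.inr : Fin n → Fin n ⊕ Fin n))) = 0

end PolyMap

end

/-!
For a polynomial map `H` with Jacobian matrix of rank one, all components have proportional
gradients. The polynomial form of Lüroth's theorem (`exists_forall_proportionalGrad_eq_aeval`) then
gives `H = h(p)` with one polynomial `p` in `n` variables and univariate `h₁, …, hₙ`. Since
`det J(x + H) = 1 + ∑ hᵢ'(p) ∂ᵢp` is a constant `c`, the polynomial `∑ hᵢ'(t) ∂ᵢp - (c - 1)` vanishes
at `t = p`; as its degree in `x` is less than that of `p`, it vanishes for an independent variable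
`t` too (`sum_derivative_mul_pderiv`). For `c = 1`, the substitution `t = p(y)` is the identity
`JH(x) · JH(y) = 0`.

In terms of the coefficient vectors `vₖ` of `h`, the identity says that `p` is constant in the
directions `vₖ` with `k ≥ 2`, and has derivative `c - 1` in the direction `v₁`. So
`x + H = x + ∑ₖ pᵏ vₖ` is the composition of a translation, of `x + p v₁`, and of the shears
`x + pᵏ vₖ` with `k ≥ 2`, which leave `p` invariant. These shears are linearly conjugate to
elementary maps, and `x + p v₁` is one more such shear followed by a linear map
(`isTame_add_sum_pow`).

Lüroth's theorem is proved by a direct argument. Let `g` be a nonconstant polynomial, and let `q`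
be an irreducible factor of `g(x) - g(y)` that vanishes on the diagonal `x = y`. By the Jacobian
criterion (`ProportionalGrad.isAlgebraic`), every `f` with gradient proportional to that of `g` is
algebraic over `K[g]`, and then `q` divides `f(x) - f(y)` (`IsDiagonalFactor.dvd_delta`). This
applies to the coefficients of `q` as a polynomial in `x`, because vector fields in `y` that kill
`g` kill them as well. Comparing degrees in `x` and in `y`, one finds that `q` is `p(x) - p(y)` up to
a constant factor, for any nonconstant coefficient `p` (`IsDiagonalFactor.exists_delta_dvd`).
Finally, setting `y = 0` in `p(x) - p(y) ∣ f(x) - f(y)` allows one to expand `f` in powers of `p` by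
induction on the degree.
-/

/-! ### Proportional gradients and algebraic dependence -/

/-- In characteristic zero, an element `x` algebraic over a domain `R` is a simple root of some
polynomial over `R`. -/
theorem IsAlgebraic.exists_aeval_eq_zero_aeval_derivative_ne_zero {R A : Type*} [CommRing R]
    [CommRing A] [IsDomain A] [Algebra R A] [FaithfulSMul R A] [CharZero R] {x : A}
    (hx : IsAlgebraic R x) :
    ∃ P : Polynomial R, Polynomial.aeval x P = 0 ∧
      Polynomial.aeval x (Polynomial.derivative P) ≠ 0 := by
  classical
  have : IsDomain R := (FaithfulSMul.algebraMap_injective R A).isDomain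
  have hex : ∃ d, ∃ P : Polynomial R, P ≠ 0 ∧ Polynomial.aeval x P = 0 ∧ P.natDegree = d := by
    obtain ⟨P, h0, h1⟩ := hx
    exact ⟨_, P, h0, h1, rfl⟩
  obtain ⟨P, hP0, hPx, hPd⟩ := Nat.find_spec hex
  refine ⟨P, hPx, fun h => ?_⟩
  have hdeg : P.natDegree ≠ 0 := by
    intro hd
    rw [Polynomial.eq_C_of_natDegree_eq_zero hd, Polynomial.aeval_C,
      map_eq_zero_iff _ (FaithfulSMul.algebraMap_injective R A)] at hPx
    apply hP0
    rw [Polynomial.eq_C_of_natDegree_eq_zero hd, hPx, Polynomial.C_0]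
  have hlt : (Polynomial.derivative P).natDegree < Nat.find hex := by
    rw [← hPd]; exact Polynomial.natDegree_derivative_lt hdeg
  refine Nat.find_min hex hlt ⟨_, fun h0 => hdeg ?_, h, rfl⟩
  exact Polynomial.derivative_eq_zero.mp h0

/-- A derivation that vanishes on `s` vanishes on every element algebraic over `K[s]`. -/
theorem Derivation.eq_zero_of_isAlgebraic_adjoin {K A M : Type*} [Field K] [CharZero K]
    [CommRing A] [IsDomain A] [Algebra K A] [AddCommGroup M] [Module K M] [Module A M]
    [IsScalarTower K A M] [Module.IsTorsionFree A M]
    (D : Derivation K A M) {s : Set A} (hs : ∀ y ∈ s, D y = 0) {x : A}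
    (hx : IsAlgebraic (Algebra.adjoin K s) x) : D x = 0 := by
  have hB : ∀ b : Algebra.adjoin K s, D (b : A) = 0 := fun b =>
    Derivation.eqOn_adjoin (D1 := D) (D2 := 0) (fun y hy => hs y hy) b.2
  let D' : Derivation (Algebra.adjoin K s) A M := Derivation.mk'
    { toFun := D
      map_add' := fun a b => map_add D a b
      map_smul' := fun b a => by
        change D ((b : A) * a) = (b : A) • D a
        rw [D.leibniz, hB, smul_zero, add_zero] }
    (fun a b => D.leibniz a b)
  have hc : CharZero (Algebra.adjoin K s) := 
    charZero_of_injective_algebraMap (FaithfulSMul.algebraMap_injective K _)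
  obtain ⟨P, h0, h1⟩ := hx.exists_aeval_eq_zero_aeval_derivative_ne_zero
  have h2 : D' (Polynomial.aeval x P) = Polynomial.aeval x (Polynomial.derivative P) • D' x :=
    D'.map_aeval P x
  rw [h0, map_zero] at h2
  exact (smul_eq_zero.mp h2.symm).resolve_left h1

namespace MvPolynomial

variable {n : ℕ} {K : Type*} [Field K]

/-- The gradients of `f` and `g` are proportional over the field of rational functions: all
`2 × 2` minors of the Jacobian matrix of `(f, g)` vanish. -/
def ProportionalGrad (f g : MvPolynomial (Fin n) K) : Prop :=
  ∀ a b, pderiv a f * pderiv b g = pderiv b f * pderiv a g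

/-- The Jacobian criterion for two polynomials: proportional gradients force algebraic dependence.
Otherwise `f`, `g` extend to a transcendence basis of `n` elements. A vector field killing all of
them but `f` solves `n - 1` linear equations in `n` unknowns, so there is a nonzero one; it kills
`f` as well, hence everything. -/
theorem ProportionalGrad.isAlgebraic [CharZero K] {f g : MvPolynomial (Fin n) K}
    (hfg : ProportionalGrad f g) {i : Fin n} (hg : pderiv i g ≠ 0) :
    IsAlgebraic (Algebra.adjoin K {g}) f := by
  classical
  by_contra hf
  have hgt : Transcendental K g := by
    intro hga
    apply hg
    refine (pderiv i).eq_zero_of_isAlgebraic_adjoin (s := ∅) (by simp) ?_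
    exact hga.extendScalars (FaithfulSMul.algebraMap_injective K _)
  have hind : AlgebraicIndepOn K id ({g} : Set (MvPolynomial (Fin n) K)) :=
    
    (algebraicIndependent_singleton_iff (⟨g, rfl⟩ : ({g} : Set _))).mpr hgt
  have hind2 : AlgebraicIndepOn K id (insert f {g} : Set (MvPolynomial (Fin n) K)) :=
    hind.insert (by rw [Set.image_id]; exact hf)
  obtain ⟨t, hst, ht⟩ := exists_isTranscendenceBasis_superset hind2
  have hft : f ∈ t := hst (by simp)
  have hgt' : g ∈ t := hst (by simp)
  have hne : g ≠ f := by
    rintro rfl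
    exact hf (isAlgebraic_algebraMap (⟨g, Algebra.subset_adjoin rfl⟩ : Algebra.adjoin K {g}))
  have hcard : Cardinal.mk t = n := by
    have := ht.lift_cardinalMk_eq_trdeg
    rw [MvPolynomial.trdeg_of_isDomain] at this
    simpa using this
  have hfin : Finite t := by
    rw [← Cardinal.lt_aleph0_iff_finite, hcard]; exact Cardinal.natCast_lt_aleph0
  have : Fintype t := Fintype.ofFinite t
  have hcard' : Fintype.card t = n := by
    rw [Cardinal.mk_fintype] at hcard; exact_mod_cast hcard
  let L := FractionRing (MvPolynomial (Fin n) K)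
  let φ : MvPolynomial (Fin n) K →+* L := algebraMap _ _
  let T := {b : t // (b : MvPolynomial (Fin n) K) ≠ f}
  have hT : Fintype.card T < n :=
    (Fintype.card_subtype_lt (x := (⟨f, hft⟩ : t)) (not_not.mpr rfl)).trans_eq hcard'
  let Φ : (Fin n → L) →ₗ[L] (T → L) :=
    { toFun := fun c b => ∑ j, c j * φ (pderiv j (b.1 : MvPolynomial (Fin n) K))
      map_add' := fun c d => by
        ext b; simp [add_mul, Finset.sum_add_distrib]
      map_smul' := fun r c => by
        ext b
        simp only [Pi.smul_apply, smul_eq_mul, mul_assoc, RingHom.id_apply]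
        exact (Finset.mul_sum _ _ _).symm }
  obtain ⟨c, hcker, hc⟩ := Submodule.exists_mem_ne_zero_of_ne_bot
    (Φ.ker_ne_bot_of_finrank_lt (by simpa using hT))
  have hval : ∀ p, mkDerivation K c p = ∑ j, c j * φ (pderiv j p) := by
    intro p
    let D2 : Derivation K (MvPolynomial (Fin n) K) L :=
      ∑ j, c j • ((Algebra.linearMap (MvPolynomial (Fin n) K) L).compDer (pderiv j))
    have hD2 : ∀ q, D2 q = ∑ j, c j * φ (pderiv j q) := fun q => by
      rw [← Derivation.coeFnAddMonoidHom_apply, map_sum, Finset.sum_apply]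
      rfl
    have h : mkDerivation K c = D2 := by
      refine MvPolynomial.derivation_ext fun k => ?_
      simp [hD2, pderiv_X, Pi.single_apply, mkDerivation_X, apply_ite]
    rw [h, hD2]
  have hker : ∀ b ∈ t, b ≠ f → mkDerivation K c b = 0 := by
    intro b hb hbf
    rw [hval]
    exact congrFun (LinearMap.mem_ker.mp hcker) ⟨⟨b, hb⟩, hbf⟩
  have hkg := hker g hgt' hne
  have hkf : mkDerivation K c f = 0 := by
    rw [hval] at hkg ⊢
    have hφ : φ (pderiv i g) ≠ 0 := by
      simpa [φ] using hg
    refine (mul_eq_zero.mp (?_ : φ (pderiv i g) * _ = 0)).resolve_left hφ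
    rw [Finset.mul_sum, ← mul_zero (φ (pderiv i f)), ← hkg, Finset.mul_sum]
    refine Finset.sum_congr rfl fun j _ => ?_
    have := congrArg φ (hfg j i)
    rw [map_mul, map_mul] at this
    linear_combination c j * this
  have hall : ∀ p, mkDerivation K c p = 0 := by
    intro p
    have := ht.isAlgebraic
    rw [Subtype.range_coe] at this
    refine (mkDerivation K c).eq_zero_of_isAlgebraic_adjoin (s := t) (fun b hb => ?_)
      (this.isAlgebraic p)
    by_cases hbf : b = f
    · rw [hbf, hkf]
    · exact hker b hb hbf
  apply hc
  ext j
  rw [← mkDerivation_X K c j, hall]; rfl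

end MvPolynomial

/-! ### Differences `f(x) - f(y)` and their common factor -/

namespace MvPolynomial

variable {n : ℕ} {K : Type*} [Field K]

/-- The difference `f(x) - f(y)`, an element of `K[y][x]`: the coefficient ring is the polynomial
ring in the variables `y`. -/
noncomputable def delta (f : MvPolynomial (Fin n) K) :
    MvPolynomial (Fin n) (MvPolynomial (Fin n) K) :=
  map C f - C f

/-- The involution of `K[y][x]` exchanging the variables `x` and `y`. -/
noncomputable def swapVars : MvPolynomial (Fin n) (MvPolynomial (Fin n) K) →+*
    MvPolynomial (Fin n) (MvPolynomial (Fin n) K) :=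
  eval₂Hom (map C) fun j => C (X j)

theorem coeff_coeff_swapVars (q : MvPolynomial (Fin n) (MvPolynomial (Fin n) K))
    (α β : Fin n →₀ ℕ) : coeff α (coeff β (swapVars q)) = coeff β (coeff α q) := by
  induction q using MvPolynomial.induction_on' with
  | add p q hp hq => simp only [map_add, coeff_add, hp, hq]
  | monomial u r =>
    have h : swapVars (monomial u r) = C (monomial u 1) * map C r := by
      rw [swapVars, coe_eval₂Hom, eval₂_monomial, mul_comm]
      congr 1
      rw [monomial_eq, C_1, one_mul, Finsupp.prod, Finsupp.prod, map_prod]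
      simp only [map_pow]
    rw [h, coeff_C_mul, coeff_map, mul_comm, coeff_C_mul, coeff_monomial, coeff_monomial]
    split_ifs <;> simp

@[simp]
theorem swapVars_swapVars (q : MvPolynomial (Fin n) (MvPolynomial (Fin n) K)) :
    swapVars (swapVars q) = q := by
  ext α β
  rw [coeff_coeff_swapVars, coeff_coeff_swapVars]

theorem swapVars_delta (f : MvPolynomial (Fin n) K) : swapVars (delta f) = -delta f := by
  have h1 : swapVars (C f) = map C f := by simp [swapVars]
  have h2 : swapVars (map C f) = C f := by rw [← h1, swapVars_swapVars]
  rw [delta, map_sub, h1, h2, neg_sub]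

theorem prime_swapVars {q : MvPolynomial (Fin n) (MvPolynomial (Fin n) K)} (hq : Prime q) :
    Prime (swapVars q) := by
  let e : MvPolynomial (Fin n) (MvPolynomial (Fin n) K) ≃+*
      MvPolynomial (Fin n) (MvPolynomial (Fin n) K) :=
    RingEquiv.ofRingHom swapVars swapVars (RingHom.ext swapVars_swapVars)
      (RingHom.ext swapVars_swapVars)
  exact (MulEquiv.prime_iff e).mpr hq

theorem eval_X_map_C (f : MvPolynomial (Fin n) K) : eval X (map C f) = f := by
  rw [eval_map]; exact eval₂_eta f

theorem eval_X_swapVars (q : MvPolynomial (Fin n) (MvPolynomial (Fin n) K)) :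
    eval X (swapVars q) = eval X q := by
  induction q using MvPolynomial.induction_on with
  | C a => simp [swapVars]
  | add p q hp hq => simp only [map_add, hp, hq]
  | mul_X p i hp => rw [map_mul, map_mul, map_mul, hp]; simp [swapVars]

theorem eval_X_delta (f : MvPolynomial (Fin n) K) : eval X (delta f) = 0 := by
  simp [delta]

theorem degree_map_C (m : MonomialOrder (Fin n)) (f : MvPolynomial (Fin n) K) :
    m.degree (map (C : K →+* MvPolynomial (Fin n) K) f) = m.degree f := by
  rw [MonomialOrder.degree, MonomialOrder.degree, support_map_of_injective _ (C_injective _ _)]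

theorem degree_C_lt_degree_map_C (m : MonomialOrder (Fin n)) {f : MvPolynomial (Fin n) K}
    (hf : m.degree f ≠ 0) :
    m.toSyn (m.degree (C f : MvPolynomial (Fin n) (MvPolynomial (Fin n) K))) <
      m.toSyn (m.degree (map (C : K →+* MvPolynomial (Fin n) K) f)) := by
  rw [degree_map_C, m.degree_C, map_zero]
  exact lt_of_le_of_ne (by simp)
    (fun h => hf (by simpa using h.symm))

theorem degree_delta (m : MonomialOrder (Fin n)) (f : MvPolynomial (Fin n) K) :
    m.degree (delta f) = m.degree f := by
  by_cases hf : m.degree f = 0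
  · rw [hf, m.eq_C_of_degree_eq_zero hf]
    simp [delta]
  · rw [delta, m.degree_sub_of_lt (degree_C_lt_degree_map_C m hf), degree_map_C]

theorem leadingCoeff_delta (m : MonomialOrder (Fin n)) {f : MvPolynomial (Fin n) K}
    (hf : m.degree f ≠ 0) : m.leadingCoeff (delta f) = C (m.leadingCoeff f) := by
  rw [delta, m.leadingCoeff_sub_of_lt (degree_C_lt_degree_map_C m hf), MonomialOrder.leadingCoeff,
    degree_map_C, coeff_map]; rfl

/-- The leading term in `x` of `f(x) - f(y)` does not involve `y`, hence neither does that of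
a divisor. -/
theorem isUnit_leadingCoeff_of_dvd_delta (m : MonomialOrder (Fin n)) {f : MvPolynomial (Fin n) K}
    (hf : m.degree f ≠ 0) {q : MvPolynomial (Fin n) (MvPolynomial (Fin n) K)}
    (hq : q ∣ delta f) : IsUnit (m.leadingCoeff q) := by
  obtain ⟨w, hw⟩ := hq
  have h := leadingCoeff_delta m hf
  rw [hw, m.leadingCoeff_mul] at h
  refine isUnit_of_dvd_unit (Dvd.intro _ h) ?_
  rw [isUnit_map_iff, isUnit_iff_ne_zero, Ne, m.leadingCoeff_eq_zero_iff]
  rintro rfl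
  exact hf m.degree_zero

/-- The coefficientwise action on `K[y][x]` of a derivation in the variables `y`. -/
noncomputable def coeffwise
    (D : Derivation K (MvPolynomial (Fin n) K) (MvPolynomial (Fin n) K))
    (q : MvPolynomial (Fin n) (MvPolynomial (Fin n) K)) :
    MvPolynomial (Fin n) (MvPolynomial (Fin n) K) :=
  ∑ α ∈ q.support, monomial α (D (coeff α q))

section coeffwise

variable (D : Derivation K (MvPolynomial (Fin n) K) (MvPolynomial (Fin n) K))

@[simp]
theorem coeff_coeffwise (q : MvPolynomial (Fin n) (MvPolynomial (Fin n) K)) (α : Fin n →₀ ℕ) :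
    coeff α (coeffwise D q) = D (coeff α q) := by
  classical
  rw [coeffwise, coeff_sum]
  simp only [coeff_monomial, Finset.sum_ite_eq', mem_support_iff]
  split_ifs with h
  · rfl
  · rw [not_not.mp h, map_zero]

theorem coeffwise_mul (p q : MvPolynomial (Fin n) (MvPolynomial (Fin n) K)) :
    coeffwise D (p * q) = p * coeffwise D q + coeffwise D p * q := by
  ext1 α
  simp only [coeff_coeffwise, coeff_add, coeff_mul, map_sum, D.leibniz, smul_eq_mul,
    Finset.sum_add_distrib]
  congr 1
  exact Finset.sum_congr rfl fun _ _ => mul_comm _ _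

theorem coeffwise_delta {f : MvPolynomial (Fin n) K} (hf : D f = 0) :
    coeffwise D (delta f) = 0 := by
  ext1 α
  rw [coeff_coeffwise, delta, coeff_sub, map_sub, coeff_map, derivation_C, coeff_C]
  split_ifs <;> simp [hf]

/-- If `q` is a prime factor of multiplicity one of `g(x) - g(y)`, then a derivation `D` killing
`g` kills the coefficients of `q`: it maps `q` to a multiple of `q`, but of lower degree in `x`. -/
theorem derivation_coeff_eq_zero_of_delta_eq_mul {m : MonomialOrder (Fin n)}
    {g : MvPolynomial (Fin n) K} (hg : m.degree g ≠ 0) (hD : D g = 0)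
    {q w : MvPolynomial (Fin n) (MvPolynomial (Fin n) K)} (hq : Prime q) (hqw : delta g = q * w)
    (hw : ¬ q ∣ w) (α : Fin n →₀ ℕ) : D (coeff α q) = 0 := by
  suffices h : coeffwise D q = 0 by rw [← coeff_coeffwise, h, coeff_zero]
  have h0 := coeffwise_delta D hD
  rw [hqw, coeffwise_mul] at h0
  have hdvd : q ∣ coeffwise D q * w :=
    (dvd_add_right (dvd_mul_right q _)).mp (h0 ▸ dvd_zero q)
  obtain ⟨s, hs⟩ := (hq.dvd_or_dvd hdvd).resolve_right hw
  by_contra hne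
  -- the leading coefficient of `q` is a constant, so `D` lowers the degree of `q` in `x`
  have hlc : coeff (m.degree q) (coeffwise D q) = 0 := by
    obtain ⟨u, -, hu⟩ := (isUnit_iff_eq_C_of_isReduced).mp
      (isUnit_leadingCoeff_of_dvd_delta m hg (Dvd.intro _ hqw.symm))
    rw [coeff_coeffwise]
    change D (m.leadingCoeff q) = 0
    rw [hu, derivation_C]
  have hle : m.toSyn (m.degree (coeffwise D q)) ≤ m.toSyn (m.degree q) := by
    refine m.degree_le_degree_of_support_subset fun β hβ => ?_
    rw [mem_support_iff, coeff_coeffwise] at hβ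
    rw [mem_support_iff]
    intro h
    exact hβ (by rw [h, map_zero])
  have hs0 : s ≠ 0 := by rintro rfl; exact hne (by rw [hs, mul_zero])
  have hge : m.toSyn (m.degree q) ≤ m.toSyn (m.degree (coeffwise D q)) := by
    rw [hs, m.degree_mul hq.ne_zero hs0]
    exact m.toSyn_monotone le_self_add
  have heq := m.toSyn.injective (le_antisymm hle hge)
  exact hne (m.leadingCoeff_eq_zero_iff.mp (by rw [MonomialOrder.leadingCoeff, heq, hlc]))

end coeffwise

/-- The coefficients of `q`, polynomials in `y`, have degree at most the degree of `q` in `y`. -/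
theorem degree_coeff_le (q : MvPolynomial (Fin n) (MvPolynomial (Fin n) K))
    (m : MonomialOrder (Fin n)) (α : Fin n →₀ ℕ) :
    m.toSyn (m.degree (coeff α q)) ≤ m.toSyn (m.degree (swapVars q)) := by
  rw [m.degree_le_iff]
  intro β hβ
  refine m.le_degree ?_
  rw [mem_support_iff] at hβ ⊢
  intro h
  rw [← coeff_coeff_swapVars, h, coeff_zero] at hβ
  exact hβ rfl

/-- `q` is an irreducible factor of `g(x) - g(y)` that vanishes on the diagonal `x = y`. -/
structure IsDiagonalFactor (g : MvPolynomial (Fin n) K)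
    (q : MvPolynomial (Fin n) (MvPolynomial (Fin n) K)) : Prop where
  prime : Prime q
  dvd : q ∣ delta g
  diag : eval X q = 0

theorem exists_prime_dvd_eval_X_eq_zero
    (a : MvPolynomial (Fin n) (MvPolynomial (Fin n) K)) (ha : a ≠ 0) (h : eval X a = 0) :
    ∃ q, Prime q ∧ q ∣ a ∧ eval X q = 0 := by
  induction a using UniqueFactorizationMonoid.induction_on_prime with
  | h₁ => exact absurd rfl ha
  | h₂ x hx =>
    exact absurd h (hx.map (eval X : _ →+* MvPolynomial (Fin n) K)).ne_zero
  | h₃ a p ha0 hp ih =>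
    rw [map_mul, mul_eq_zero] at h
    rcases h with h | h
    · exact ⟨p, hp, dvd_mul_right _ _, h⟩
    · obtain ⟨q, hq, hqa, hq0⟩ := ih ha0 h
      exact ⟨q, hq, hqa.mul_left p, hq0⟩

theorem exists_isDiagonalFactor {m : MonomialOrder (Fin n)} {g : MvPolynomial (Fin n) K}
    (hg : m.degree g ≠ 0) : ∃ q, IsDiagonalFactor g q := by
  have h0 : delta g ≠ 0 := m.ne_zero_of_degree_ne_zero (by rwa [degree_delta])
  obtain ⟨q, h1, h2, h3⟩ := exists_prime_dvd_eval_X_eq_zero _ h0 (eval_X_delta g)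
  exact ⟨q, h1, h2, h3⟩

namespace IsDiagonalFactor

variable {g : MvPolynomial (Fin n) K} {q : MvPolynomial (Fin n) (MvPolynomial (Fin n) K)}

theorem swapVars (hq : IsDiagonalFactor g q) : IsDiagonalFactor g (swapVars q) where
  prime := prime_swapVars hq.prime
  dvd := by
    have := map_dvd MvPolynomial.swapVars hq.dvd
    rw [swapVars_delta] at this
    exact (dvd_neg (α := MvPolynomial (Fin n) (MvPolynomial (Fin n) K))).mp this
  diag := by rw [eval_X_swapVars, hq.diag]

/-- Along the diagonal, `g(x) - g(y)` vanishes only to first order. -/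
theorem not_dvd_of_delta_eq_mul (hq : IsDiagonalFactor g q) {i : Fin n} (hg : pderiv i g ≠ 0)
    {w : MvPolynomial (Fin n) (MvPolynomial (Fin n) K)} (hw : delta g = q * w) : ¬ q ∣ w := by
  rintro ⟨v, rfl⟩
  apply hg
  have h := congrArg (fun p => eval X (pderiv i p)) hw
  simpa [delta, pderiv_map, eval_X_map_C, Derivation.leibniz, hq.diag] using h

/-- A diagonal factor of `g(x) - g(y)` divides `f(x) - f(y)` whenever `f` is algebraic over `K[g]`:
modulo `q` both `f(x)` and `f(y)` are roots of one polynomial `P` over `K[g(x)] = K[g(y)]`, they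
agree on the diagonal, and there `f` is a simple root of `P`. -/
theorem dvd_delta (hq : IsDiagonalFactor g q) [CharZero K] {f : MvPolynomial (Fin n) K}
    (hf : IsAlgebraic (Algebra.adjoin K {g}) f) : q ∣ delta f := by
  have hc : CharZero (Algebra.adjoin K {g}) :=
    charZero_of_injective_algebraMap (FaithfulSMul.algebraMap_injective K _)
  obtain ⟨P, hP0, hP1⟩ := hf.exists_aeval_eq_zero_aeval_derivative_ne_zero
  have hb : ∀ b : Algebra.adjoin K {g}, q ∣ delta (b : MvPolynomial (Fin n) K) := by
    rintro ⟨b, hb⟩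
    induction hb using Algebra.adjoin_induction with
    | mem x hx => rw [Set.mem_singleton_iff] at hx; subst hx; exact hq.dvd
    | algebraMap r => simp [delta, algebraMap_eq]
    | add x y _ _ hx hy =>
      have : delta (x + y) = delta x + delta y := by simp only [delta, map_add]; ring
      simpa only [this] using dvd_add hx hy
    | mul x y _ _ hx hy =>
      have : delta (x * y) = map C x * delta y + delta x * C y := by
        simp only [delta, map_mul]; ring
      simpa only [this] using dvd_add (hy.mul_left _) (hx.mul_right _)
  let ψ : Algebra.adjoin K {g} →+* MvPolynomial (Fin n) (MvPolynomial (Fin n) K) :=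
    C.comp (algebraMap (Algebra.adjoin K {g}) (MvPolynomial (Fin n) K))
  let Q := P.map ψ
  have hQy : ∀ R : Polynomial (Algebra.adjoin K {g}),
      (R.map ψ).eval (C f) = C (Polynomial.aeval f R) := by
    intro R
    rw [Polynomial.eval_map, Polynomial.aeval_def, Polynomial.hom_eval₂]
  -- `P(f(x))` with coefficients in `y` is congruent to `P(f(x))` with coefficients in `x`
  have hQx : q ∣ Q.eval (map C f) := by
    let χ : MvPolynomial (Fin n) K →+* MvPolynomial (Fin n) (MvPolynomial (Fin n) K) := map C
    have h1 : χ (Polynomial.aeval f P) =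
        (P.map (χ.comp (algebraMap (Algebra.adjoin K {g}) (MvPolynomial (Fin n) K)))).eval
          (χ f) := by
      rw [Polynomial.eval_map, Polynomial.aeval_def, Polynomial.hom_eval₂]
    rw [hP0, map_zero] at h1
    rw [← dvd_sub_right (h1 ▸ dvd_zero q), Polynomial.eval_map, Polynomial.eval_map,
      Polynomial.eval₂_eq_sum_range, Polynomial.eval₂_eq_sum_range, ← Finset.sum_sub_distrib]
    refine Finset.dvd_sum fun k _ => ?_
    rw [← sub_mul]
    exact (hb (P.coeff k)).mul_right _
  obtain ⟨k, hexp⟩ := Q.binomExpansion (C f) (delta f)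
  rw [show C f + delta f = map C f by simp [delta], hQy, hP0, map_zero, zero_add] at hexp
  have hder : (Polynomial.derivative Q).eval (C f) =
      C (Polynomial.aeval f (Polynomial.derivative P)) := by
    rw [← hQy, Polynomial.derivative_map]
  rw [hexp, hder, sq, ← mul_assoc, ← add_mul] at hQx
  refine (hq.prime.dvd_or_dvd hQx).resolve_left fun h => hP1 ?_
  have := map_dvd (eval X : _ →+* MvPolynomial (Fin n) K) h
  rw [hq.diag, zero_dvd_iff] at this
  simpa [eval_X_delta] using this

/-- The coefficients of a diagonal factor are killed by the vector fields
`∂g/∂y_b ∂_a - ∂g/∂y_a ∂_b`, which kill `g`. -/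
theorem proportionalGrad_coeff (hq : IsDiagonalFactor g q) {m : MonomialOrder (Fin n)} {i : Fin n}
    (hg : pderiv i g ≠ 0) (hm : m.degree g ≠ 0) (α : Fin n →₀ ℕ) :
    ProportionalGrad (coeff α q) g := by
  intro a b
  obtain ⟨w, hw⟩ := hq.dvd
  have h := derivation_coeff_eq_zero_of_delta_eq_mul
    (pderiv b g • pderiv a - pderiv a g • pderiv b) hm (by simp [mul_comm]) hq.prime hw
    (hq.not_dvd_of_delta_eq_mul hg hw) α
  simp only [Derivation.sub_apply, Derivation.smul_apply, smul_eq_mul] at h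
  linear_combination h

/-- A diagonal factor involves `y`: otherwise it would equal its restriction to the diagonal, which
is zero. -/
theorem exists_coeff_degree_ne_zero (hq : IsDiagonalFactor g q) (m : MonomialOrder (Fin n)) :
    ∃ α, m.degree (coeff α q) ≠ 0 := by
  by_contra! h
  apply hq.prime.ne_zero
  have hq0 : q = map C (map (constantCoeff : MvPolynomial (Fin n) K →+* K) q) := by
    ext1 α
    rw [coeff_map, coeff_map]
    conv_lhs => rw [m.eq_C_of_degree_eq_zero (h α)]
    conv_rhs => rw [m.eq_C_of_degree_eq_zero (h α)]
    simp
  rw [hq0, ← eval_X_map_C (map constantCoeff q), ← hq0, hq.diag, map_zero]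

theorem degree_le_of_proportionalGrad (hq : IsDiagonalFactor g q) [CharZero K] {i : Fin n}
    (hg : pderiv i g ≠ 0) (m : MonomialOrder (Fin n)) {r : MvPolynomial (Fin n) K}
    (hr : ProportionalGrad r g) (hr0 : m.degree r ≠ 0) :
    m.toSyn (m.degree q) ≤ m.toSyn (m.degree r) := by
  obtain ⟨s, hs⟩ := hq.dvd_delta (hr.isAlgebraic hg)
  rw [← degree_delta, hs, m.degree_mul' (hs ▸ m.ne_zero_of_degree_ne_zero (by rwa [degree_delta]))]
  exact m.toSyn_monotone le_self_add

/-- The diagonal factor of `g(x) - g(y)` is itself of the form `p(x) - p(y)`, up to a unit: take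
for `p` a nonconstant coefficient. Its degree is at most the degree of `q` in `y`, which by the
symmetry between `x` and `y` is the degree of `q` in `x`. -/
theorem exists_delta_dvd (hq : IsDiagonalFactor g q) [CharZero K] {i : Fin n}
    (hg : pderiv i g ≠ 0) {m : MonomialOrder (Fin n)} (hm : m.degree g ≠ 0) :
    ∃ p, ProportionalGrad p g ∧ m.degree p ≠ 0 ∧ delta p ∣ q := by
  obtain ⟨α, hα⟩ := hq.exists_coeff_degree_ne_zero m
  obtain ⟨β, hβ⟩ := hq.swapVars.exists_coeff_degree_ne_zero m
  have hp := hq.proportionalGrad_coeff hg hm α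
  have h2 : m.toSyn (m.degree (coeff α q)) ≤ m.toSyn (m.degree q) := by
    refine (degree_coeff_le q m α).trans ?_
    refine (hq.swapVars.degree_le_of_proportionalGrad hg m
      (hq.swapVars.proportionalGrad_coeff hg hm β) hβ).trans ?_
    simpa using degree_coeff_le (MvPolynomial.swapVars q) m β
  have h3 := m.toSyn.injective
    (le_antisymm h2 (hq.degree_le_of_proportionalGrad hg m hp hα))
  refine ⟨coeff α q, hp, hα, ?_⟩
  obtain ⟨s, hs⟩ := hq.dvd_delta (hp.isAlgebraic hg)
  have hds : m.degree s = 0 := by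
    have := congrArg m.degree hs
    rw [m.degree_mul' (hs ▸ m.ne_zero_of_degree_ne_zero (by rwa [degree_delta])), degree_delta,
      h3] at this
    simpa using this
  have hu : IsUnit s := by
    have := isUnit_leadingCoeff_of_dvd_delta m hα (Dvd.intro_left _ hs.symm)
    rw [m.eq_C_of_degree_eq_zero hds]
    exact this.map C
  rw [hs]
  exact (associated_mul_unit_left q s hu).dvd

end IsDiagonalFactor

end MvPolynomial

/-! ### Polynomials with proportional gradients are polynomials in a single one -/

namespace MvPolynomial

variable {n : ℕ} {K : Type*} [Field K]

theorem totalDegree_ne_zero_of_pderiv_ne_zero {f : MvPolynomial (Fin n) K} {i : Fin n}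
    (hf : pderiv i f ≠ 0) : f.totalDegree ≠ 0 := by
  intro h
  rw [totalDegree_eq_zero_iff_eq_C.mp h, pderiv_C] at hf
  exact hf rfl

theorem map_eval_zero_delta (f : MvPolynomial (Fin n) K) :
    map (eval 0 : MvPolynomial (Fin n) K →+* K) (delta f) = f - C (eval 0 f) := by
  have h : (eval 0 : MvPolynomial (Fin n) K →+* K).comp C = RingHom.id K := by
    ext a; simp
  rw [delta, map_sub, map_map, map_C, h, map_id]

/-- The polynomial form of Lüroth's theorem, in any number of variables: the polynomials whose
gradients are proportional to that of a fixed nonconstant `g` are the polynomials in a single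
`p`. -/
theorem exists_forall_proportionalGrad_eq_aeval [CharZero K] {g : MvPolynomial (Fin n) K}
    {i : Fin n} (hg : pderiv i g ≠ 0) :
    ∃ p : MvPolynomial (Fin n) K, ∀ f, ProportionalGrad f g →
      ∃ h : Polynomial K, f = Polynomial.aeval p h := by
  let m : MonomialOrder (Fin n) := MonomialOrder.lex
  have hm : m.degree g ≠ 0 := by
    intro h
    rw [m.eq_C_of_degree_eq_zero h, pderiv_C] at hg
    exact hg rfl
  obtain ⟨q, hq⟩ := exists_isDiagonalFactor hm
  obtain ⟨p, hpg, hp, hpq⟩ := hq.exists_delta_dvd hg hm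
  refine ⟨p, fun f => ?_⟩
  induction hd : f.totalDegree using Nat.strong_induction_on generalizing f with
  | _ d ih =>
  intro hf
  by_cases hd0 : f.totalDegree = 0
  · exact ⟨Polynomial.C (coeff 0 f), by
      rw [Polynomial.aeval_C, algebraMap_eq]; exact totalDegree_eq_zero_iff_eq_C.mp hd0⟩
  -- putting `y = 0` in `p(x) - p(y) ∣ f(x) - f(y)` gives `f - f(0) = (p - p(0)) * w`
  obtain ⟨w, hw⟩ := map_dvd (map (eval 0 : MvPolynomial (Fin n) K →+* K))
    (hpq.trans (hq.dvd_delta (hf.isAlgebraic hg)))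
  rw [map_eval_zero_delta, map_eval_zero_delta] at hw
  set p₀ := p - C (eval 0 p) with hp₀
  have hp₀d : p₀.totalDegree ≠ 0 := by
    intro h
    apply hp
    rw [← sub_add_cancel p (C (eval 0 p)), ← hp₀, totalDegree_eq_zero_iff_eq_C.mp h, ← C_add,
      m.degree_C]
  have hp₀0 : p₀ ≠ 0 := fun h => hp₀d (by rw [h, totalDegree_zero])
  have hfeq : f = p₀ * w + C (eval 0 f) := by rw [← hw, sub_add_cancel]
  have hw0 : w ≠ 0 := by
    rintro rfl
    rw [mul_zero, zero_add] at hfeq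
    exact hd0 (by rw [hfeq, totalDegree_C])
  have hwg : ProportionalGrad w g := by
    intro a b
    refine mul_left_cancel₀ hp₀0 ?_
    have h1 := hf a b
    rw [hfeq] at h1
    simp only [hp₀, map_add, map_sub, Derivation.leibniz, pderiv_C, smul_eq_mul] at h1
    rw [hp₀]
    linear_combination h1 - w * hpg a b
  have hlt : w.totalDegree < d := by
    have h1 := totalDegree_mul_of_isDomain hp₀0 hw0
    have h2 := totalDegree_sub_C_le f (eval 0 f)
    rw [hw, h1] at h2
    omega
  obtain ⟨h, hh⟩ := ih _ hlt w rfl hwg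
  refine ⟨(Polynomial.X - Polynomial.C (eval 0 p)) * h + Polynomial.C (eval 0 f), ?_⟩
  rw [map_add, map_mul, map_sub, Polynomial.aeval_X, Polynomial.aeval_C, Polynomial.aeval_C,
    algebraMap_eq, ← hh, ← hp₀, ← hfeq]

theorem totalDegree_pderiv_lt {p : MvPolynomial (Fin n) K} (hp : p.totalDegree ≠ 0) (i : Fin n) :
    (pderiv i p).totalDegree < p.totalDegree := by
  rw [totalDegree, Finset.sup_lt_iff (Nat.pos_of_ne_zero hp)]
  intro s hs
  rw [mem_support_iff, coeff_pderiv] at hs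
  have h := le_totalDegree (mem_support_iff.mpr (left_ne_zero_of_mul hs))
  rw [Finsupp.sum_add_index' (fun _ => rfl) (fun _ _ _ => rfl), Finsupp.sum_single_index rfl] at h
  omega

/-- A polynomial in `p` whose coefficients have degree less than that of `p` is determined by its
value: expansions in base `p` are unique. -/
theorem eq_zero_of_eval_eq_zero_of_totalDegree_lt {p : MvPolynomial (Fin n) K}
    (E : Polynomial (MvPolynomial (Fin n) K)) (hE : ∀ k, (E.coeff k).totalDegree < p.totalDegree)
    (h : E.eval p = 0) : E = 0 := by
  induction hd : E.natDegree generalizing E with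
  | zero =>
    rw [Polynomial.eq_C_of_natDegree_eq_zero hd, Polynomial.eval_C] at h
    rw [Polynomial.eq_C_of_natDegree_eq_zero hd, h, Polynomial.C_0]
  | succ d ih =>
    have hE1 := E.divX_mul_X_add
    have hev : E.divX.eval p * p = -E.coeff 0 := by
      rw [← hE1] at h
      simpa [add_eq_zero_iff_eq_neg] using h
    have hz : E.divX.eval p = 0 := by
      by_contra hne
      have hp0 : p ≠ 0 := by
        rintro rfl
        exact absurd (hE 0) (by simp)
      have h1 := totalDegree_mul_of_isDomain hne hp0
      rw [hev, totalDegree_neg] at h1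
      have := hE 0
      omega
    have h2 := ih E.divX (fun k => by rw [Polynomial.coeff_divX]; exact hE _) hz (by
      rw [Polynomial.natDegree_divX_eq_natDegree_tsub_one, hd]; rfl)
    rw [hz, zero_mul, zero_eq_neg] at hev
    rw [← hE1, h2, hev]
    simp

end MvPolynomial

/-! ### The structure of Keller maps `x + H` with Jacobian of `H` of rank one -/

namespace PolyMap

open MvPolynomial

variable {n : ℕ} {K : Type*} [Field K]

theorem proportionalGrad_of_polyRank_eq_one {H : PolyMap n K} (h : polyRank (jacobian H) = 1)
    (i j : Fin n) : ProportionalGrad (H i) (H j) := by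
  rw [polyRank, Matrix.rank_eq_finrank_span_row] at h
  obtain ⟨v, hv⟩ := finrank_le_one_iff.mp h.le
  have hrow : ∀ i, ∃ c, ∀ a, algebraMap _ (FractionRing (MvPolynomial (Fin n) K))
      (pderiv a (H i)) = c * (v : Fin n → _) a := by
    intro i
    obtain ⟨c, hc⟩ := hv ⟨_, Submodule.subset_span (Set.mem_range_self i)⟩
    exact ⟨c, fun a => (congrFun (congrArg Subtype.val hc) a).symm⟩
  obtain ⟨c, hc⟩ := hrow i
  obtain ⟨d, hd⟩ := hrow j
  intro a b
  apply IsFractionRing.injective _ (FractionRing (MvPolynomial (Fin n) K))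
  rw [map_mul, map_mul, hc, hc, hd, hd]
  ring

theorem exists_pderiv_ne_zero_of_polyRank_eq_one {H : PolyMap n K}
    (h : polyRank (jacobian H) = 1) : ∃ i j, pderiv j (H i) ≠ 0 := by
  by_contra! h0
  have : jacobian H = 0 := by
    ext1 i j
    exact h0 i j
  rw [polyRank, this, Matrix.map_zero _ (map_zero _), Matrix.rank_zero] at h
  exact zero_ne_one h

theorem jacobian_ident_add (H : PolyMap n K) : jacobian (ident n K + H) = 1 + jacobian H := by
  ext1 i j
  rw [jacobian, Matrix.of_apply, Pi.add_apply, map_add, Matrix.add_apply, jacobian,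
    Matrix.of_apply, ident, pderiv_X, Matrix.one_apply, Pi.single_apply]

theorem pderiv_aeval (p : MvPolynomial (Fin n) K) (h : Polynomial K) (j : Fin n) :
    pderiv j (Polynomial.aeval p h) =
      Polynomial.aeval p (Polynomial.derivative h) * pderiv j p := by
  rw [Derivation.map_aeval, smul_eq_mul]

/-- If `x + h(p)` has constant Jacobian determinant `c`, then `∑ hᵢ'(t) ∂ᵢ p = c - 1` for an
independent variable `t`, not only for `t = p`: the difference of the two sides has degree less
than `deg p` in `x` and vanishes at `t = p`. -/
theorem sum_derivative_mul_pderiv {p : MvPolynomial (Fin n) K} {h : Fin n → Polynomial K} {c : K}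
    (hp : p.totalDegree ≠ 0)
    (hdet : (jacobian (ident n K + fun i => Polynomial.aeval p (h i))).det = C c) :
    ∑ i, (Polynomial.derivative (h i)).map C * Polynomial.C (pderiv i p) =
      Polynomial.C (C (c - 1)) := by
  have hJ : jacobian (fun i => Polynomial.aeval p (h i)) =
      Matrix.replicateCol Unit (fun i => Polynomial.aeval p (Polynomial.derivative (h i))) *
        Matrix.replicateRow Unit (fun j => pderiv j p) := by
    ext1 i j
    simp [jacobian, Matrix.mul_apply]
  rw [jacobian_ident_add, hJ, Matrix.det_one_add_replicateCol_mul_replicateRow] at hdet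
  rw [← sub_eq_zero]
  refine eq_zero_of_eval_eq_zero_of_totalDegree_lt (p := p) _ (fun k => ?_) ?_
  · have hpos := Nat.pos_of_ne_zero hp
    have h1 : (∑ i, C ((Polynomial.derivative (h i)).coeff k) * pderiv i p).totalDegree <
        p.totalDegree := by
      refine (totalDegree_finsetSum _ _).trans_lt ?_
      rw [Finset.sup_lt_iff hpos]
      intro i _
      refine (totalDegree_mul _ _).trans_lt ?_
      rw [totalDegree_C, zero_add]
      exact totalDegree_pderiv_lt hp i
    rw [Polynomial.coeff_sub, Polynomial.finsetSum_coeff]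
    simp only [Polynomial.coeff_mul_C, Polynomial.coeff_map]
    refine (totalDegree_sub _ _).trans_lt (max_lt h1 ?_)
    rw [Polynomial.coeff_C]
    split_ifs
    · rwa [totalDegree_C]
    · rwa [totalDegree_zero]
  · have h2 : ∀ f : Polynomial K, (f.map C).eval p = Polynomial.aeval p f := by
      intro f
      rw [Polynomial.eval_map, Polynomial.aeval_def]; rfl
    rw [dotProduct] at hdet
    simp only [Polynomial.eval_sub, Polynomial.eval_finsetSum, Polynomial.eval_mul, h2,
      Polynomial.eval_C, C_sub, C_1]
    rw [← hdet, add_sub_cancel_left, sub_eq_zero]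
    exact Finset.sum_congr rfl fun i _ => mul_comm _ _

end PolyMap

/-! ### Tame maps and shears -/

namespace PolyMap

open MvPolynomial

variable {n : ℕ} {K : Type*} [Field K]

theorem comp_assoc (F G H : PolyMap n K) : (F.comp G).comp H = F.comp (G.comp H) := by
  funext i
  exact bind₁_bind₁ G H (F i)

theorem ident_comp (F : PolyMap n K) : (ident n K).comp F = F := by
  funext i
  simp [comp, ident]

theorem bind₁_ident (q : MvPolynomial (Fin n) K) : bind₁ (ident n K) q = q :=
  congrFun (congrArg DFunLike.coe (bind₁_X_left (σ := Fin n) (R := K))) q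

/-- The linear map `x ↦ A x`. -/
noncomputable def linear (A : Matrix (Fin n) (Fin n) K) : PolyMap n K :=
  fun i => ∑ j, C (A i j) * X j

/-- The translation `x ↦ x + b`. -/
noncomputable def translation (b : Fin n → K) : PolyMap n K := fun i => X i + C (b i)

/-- The map `x ↦ x + q(x) v`, moving each point in the direction of the vector `v`. -/
noncomputable def shear (v : Fin n → K) (q : MvPolynomial (Fin n) K) : PolyMap n K :=
  fun i => X i + C (v i) * q

theorem linear_comp_apply (A : Matrix (Fin n) (Fin n) K) (F : PolyMap n K) (i : Fin n) :
    (linear A).comp F i = ∑ j, C (A i j) * F j := by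
  simp [comp, linear, map_sum]

theorem linear_one : linear (1 : Matrix (Fin n) (Fin n) K) = ident n K := by
  funext i
  simp [linear, ident, Matrix.one_apply, apply_ite]

theorem linear_comp_linear (A B : Matrix (Fin n) (Fin n) K) :
    (linear A).comp (linear B) = linear (A * B) := by
  funext i
  rw [linear_comp_apply]
  simp only [linear, Matrix.mul_apply, map_sum, Finset.mul_sum, Finset.sum_mul, map_mul]
  rw [Finset.sum_comm]
  exact Finset.sum_congr rfl fun _ _ => Finset.sum_congr rfl fun _ _ => (mul_assoc _ _ _).symm

theorem isAffine_linear (A : GL (Fin n) K) : IsAffine (linear A.val) :=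
  ⟨A, 0, fun i => by simp [linear]⟩

theorem isAffine_translation (b : Fin n → K) : IsAffine (translation b) := by
  refine ⟨1, b, fun i => ?_⟩
  simp [translation, Matrix.one_apply, apply_ite]

theorem isTame_ident : IsTame (ident n K) := by
  rw [← linear_one]
  exact .affine (isAffine_linear 1)

/-- The derivative in the direction of the constant vector `v`. -/
noncomputable def dirDeriv (v : Fin n → K) :
    Derivation K (MvPolynomial (Fin n) K) (MvPolynomial (Fin n) K) :=
  mkDerivation K fun i => C (v i)

theorem dirDeriv_apply (v : Fin n → K) (q : MvPolynomial (Fin n) K) :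
    dirDeriv v q = ∑ i, C (v i) * pderiv i q := by
  induction q using MvPolynomial.induction_on with
  | C a => simp
  | add p q hp hq => simp only [map_add, hp, hq, mul_add, Finset.sum_add_distrib]
  | mul_X p i hp =>
    simp only [Derivation.leibniz, hp, smul_eq_mul, mul_add, Finset.sum_add_distrib, pderiv_X]
    congr 1
    · simp [dirDeriv, mkDerivation_X, Pi.single_apply, mul_comm]
    · rw [Finset.mul_sum]
      exact Finset.sum_congr rfl fun _ _ => by ring

theorem pderiv_bind₁_linear (A : Matrix (Fin n) (Fin n) K) (i : Fin n)
    (q : MvPolynomial (Fin n) K) :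
    pderiv i (bind₁ (linear A) q) = bind₁ (linear A) (dirDeriv (fun j => A j i) q) := by
  induction q using MvPolynomial.induction_on with
  | C a => simp
  | add p q hp hq => simp only [map_add, hp, hq]
  | mul_X p j hp =>
    have h : pderiv i (linear A j) = C (A j i) := by
      simp [linear, map_sum, pderiv_X, Pi.single_apply]
    simp only [map_mul, map_add, Derivation.leibniz, hp, smul_eq_mul, bind₁_X_right, h]
    simp [dirDeriv, mkDerivation_X]

theorem notMem_vars_of_pderiv_eq_zero [CharZero K] {i : Fin n} {q : MvPolynomial (Fin n) K}
    (h : pderiv i q = 0) : i ∉ q.vars := by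
  classical
  rw [mem_vars_iff_mem_support]
  rintro ⟨d, hd, hi⟩
  have hle : Finsupp.single i 1 ≤ d := by
    rw [Finsupp.single_le_iff]
    exact Nat.one_le_iff_ne_zero.mpr (Finsupp.mem_support_iff.mp hi)
  have h1 := congrArg (coeff (d - Finsupp.single i 1)) h
  rw [coeff_pderiv, tsub_add_cancel_of_le hle, coeff_zero, mul_eq_zero] at h1
  rcases h1 with h1 | h1
  · exact mem_support_iff.mp hd h1
  · exact Nat.cast_add_one_ne_zero _ h1

theorem bind₁_congr_of_notMem_vars {F G : PolyMap n K} {i : Fin n} {q : MvPolynomial (Fin n) K}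
    (hi : i ∉ q.vars) (h : ∀ k, k ≠ i → F k = G k) : bind₁ F q = bind₁ G q := by
  refine hom_congr_vars (f₁ := (bind₁ F).toRingHom) (f₂ := (bind₁ G).toRingHom) ?_ ?_ rfl
  · ext a; simp
  · intro k hk _
    have : k ≠ i := by rintro rfl; exact hi hk
    simp [h k this]

/-- A polynomial `q` constant in the direction `v ≠ 0` does not involve the `i`-th coordinate in a
suitable linear coordinate system, whose `i`-th basis vector is `v`. -/
theorem exists_GL_bind₁_eq [CharZero K] {v : Fin n → K} (hv : v ≠ 0)
    {q : MvPolynomial (Fin n) K} (hq : dirDeriv v q = 0) :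
    ∃ (A : GL (Fin n) K) (i : Fin n) (q' : MvPolynomial (Fin n) K), (∀ j, A.val j i = v j) ∧
      i ∉ q'.vars ∧ bind₁ (linear (A⁻¹).val) q' = q := by
  obtain ⟨i, hi⟩ := Function.ne_iff.mp hv
  let B : Matrix (Fin n) (Fin n) K := (1 : Matrix (Fin n) (Fin n) K).updateCol i v
  have hB : B.det ≠ 0 := by
    rw [← Matrix.cramer_apply, Matrix.cramer_one]
    exact hi
  let A : GL (Fin n) K := Matrix.GeneralLinearGroup.mkOfDetNeZero B hB
  have hA : ∀ j, A.val j i = v j := fun j => Matrix.updateCol_self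
  refine ⟨A, i, bind₁ (linear A.val) q, hA, notMem_vars_of_pderiv_eq_zero ?_, ?_⟩
  · rw [pderiv_bind₁_linear, funext hA, hq, map_zero]
  · rw [bind₁_bind₁]
    change bind₁ ((linear A.val).comp (linear (A⁻¹).val)) q = q
    rw [linear_comp_linear, Units.mul_inv, linear_one]
    exact bind₁_ident q

/-- A shear in the direction `v` by a polynomial constant in that direction is linearly conjugate
to an elementary map. -/
theorem isTame_shear [CharZero K] {v : Fin n → K} {q : MvPolynomial (Fin n) K}
    (hq : dirDeriv v q = 0) : IsTame (shear v q) := by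
  by_cases hv : v = 0
  · have : shear v q = ident n K := by
      funext i
      simp [shear, ident, hv]
    rw [this]
    exact isTame_ident
  obtain ⟨A, i, q', hA, hi, hq'⟩ := exists_GL_bind₁_eq hv hq
  have h : shear v q = (linear A.val).comp
      (PolyMap.comp (Function.update (ident n K) i (X i + q')) (linear (A⁻¹).val)) := by
    have h1 : ∀ j, PolyMap.comp (Function.update (ident n K) i (X i + q')) (linear (A⁻¹).val) j =
        linear (A⁻¹).val j + if j = i then q else 0 := by
      intro j
      by_cases hj : j = i
      · subst hj
        simpa [comp] using hq'
      · simp [comp, hj, ident]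
    funext k
    rw [linear_comp_apply]
    simp only [h1, mul_add, Finset.sum_add_distrib]
    rw [← linear_comp_apply, linear_comp_linear, Units.mul_inv, linear_one]
    simp [hA, shear, ident]
  rw [h]
  exact .comp (.affine (isAffine_linear A))
    (.comp (.elementary ⟨i, q', hi, rfl⟩) (.affine (isAffine_linear A⁻¹)))

/-- A polynomial constant in the direction `v` is invariant under every shear in that direction. -/
theorem bind₁_shear_of_dirDeriv_eq_zero [CharZero K] {v : Fin n → K} {q : MvPolynomial (Fin n) K}
    (hq : dirDeriv v q = 0) (s : MvPolynomial (Fin n) K) : bind₁ (shear v s) q = q := by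
  by_cases hv : v = 0
  · have : shear v s = ident n K := by
      funext i
      simp [shear, ident, hv]
    rw [this]
    exact bind₁_ident q
  obtain ⟨A, i, q', hA, hi, hq'⟩ := exists_GL_bind₁_eq hv hq
  rw [← hq', bind₁_bind₁]
  refine bind₁_congr_of_notMem_vars hi fun k hk => ?_
  change (linear (A⁻¹).val).comp (shear v s) k = _
  have h0 : ∑ j, (A⁻¹).val k j * v j = 0 := by
    have := congrFun (congrFun (Units.inv_mul A) k) i
    rw [Matrix.mul_apply, Matrix.one_apply_ne hk] at this
    simpa only [hA] using this
  rw [linear_comp_apply]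
  simp only [shear, mul_add, Finset.sum_add_distrib, ← mul_assoc, ← C_mul]
  rw [← Finset.sum_mul, ← map_sum, h0, C_0, zero_mul, add_zero]
  rfl

/-- The map `x + p v` is tame when `p` has a constant derivative `c - 1` in the direction `v`: then
`p = q + (c - 1) L`, with `q` constant in the direction `v` and `L` a linear form with `L(v) = 1`,
and `x + p v` is the composition of the linear map `x + (c - 1) L v` with the shear `x + c⁻¹ q v`. -/
theorem isTame_shear_of_dirDeriv_eq_C [CharZero K] {v : Fin n → K} {p : MvPolynomial (Fin n) K}
    {c : K} (hc : c ≠ 0) (hp : dirDeriv v p = C (c - 1)) : IsTame (shear v p) := by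
  by_cases hv : v = 0
  · have : shear v p = ident n K := by
      funext i
      simp [shear, ident, hv]
    rw [this]
    exact isTame_ident
  obtain ⟨i, hi⟩ := Function.ne_iff.mp hv
  rw [Pi.zero_apply] at hi
  set q := p - C ((c - 1) / v i) * X i with hq
  have hq0 : dirDeriv v (C c⁻¹ * q) = 0 := by
    have hX : dirDeriv v (X i) = C (v i) := mkDerivation_X K _ i
    simp only [hq, Derivation.leibniz, map_sub, hp, derivation_C, hX, smul_eq_mul, mul_zero,
      add_zero, ← C_mul, div_mul_cancel₀ _ hi, sub_self]
  let B : Matrix (Fin n) (Fin n) K :=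
    1 + Matrix.replicateCol Unit (fun k => (c - 1) / v i * v k) *
      Matrix.replicateRow Unit (Pi.single i (1 : K))
  have hB : B.det ≠ 0 := by
    rw [Matrix.det_one_add_replicateCol_mul_replicateRow, single_one_dotProduct,
      div_mul_cancel₀ _ hi]
    simpa using hc
  have h : shear v p = (linear B).comp (shear v (C c⁻¹ * q)) := by
    funext k
    rw [linear_comp_apply]
    have hBk : ∀ j, B k j = (if k = j then 1 else 0) + if j = i then (c - 1) / v i * v k else 0 := by
      intro j
      simp [B, Matrix.mul_apply, Matrix.one_apply, Pi.single_apply]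
    have e1 : C c * C c⁻¹ = (1 : MvPolynomial (Fin n) K) := by rw [← C_mul, mul_inv_cancel₀ hc, C_1]
    have e2 : C ((c - 1) / v i) * C (v i) = (C c - 1 : MvPolynomial (Fin n) K) := by
      rw [← C_mul, div_mul_cancel₀ _ hi, C_sub, C_1]
    simp only [hBk, C_add, add_mul, Finset.sum_add_distrib, apply_ite C, C_1, C_0, ite_mul, one_mul,
      zero_mul, Finset.sum_ite_eq, Finset.sum_ite_eq', Finset.mem_univ, if_true, shear, C_mul]
    have e3 : p = q + C ((c - 1) / v i) * X i := by rw [hq, sub_add_cancel]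
    rw [e3]
    linear_combination (-C (v k) * q) * e1 - (C (v k) * C c⁻¹ * q) * e2
  rw [h]
  exact .comp (.affine (isAffine_linear (Matrix.GeneralLinearGroup.mkOfDetNeZero B hB)))
    (isTame_shear hq0)

theorem IsInvertible.comp {F G : PolyMap n K} (hF : IsInvertible F) (hG : IsInvertible G) :
    IsInvertible (F.comp G) := by
  obtain ⟨F', h1, h2⟩ := hF
  obtain ⟨G', h3, h4⟩ := hG
  refine ⟨G'.comp F', ?_, ?_⟩
  · rw [comp_assoc, ← comp_assoc G, h3, ident_comp, h1]
  · rw [comp_assoc, ← comp_assoc F', h2, ident_comp, h4]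

theorem IsAffine.isInvertible {F : PolyMap n K} (hF : IsAffine F) : IsInvertible F := by
  obtain ⟨A, b, h⟩ := hF
  have hFc : F = (translation b).comp (linear A.val) := by
    funext i
    simp [h, PolyMap.comp, translation, linear]
  rw [hFc]
  refine IsInvertible.comp ⟨translation (-b), ?_, ?_⟩ ⟨linear (A⁻¹).val, ?_, ?_⟩
  · funext i; simp [PolyMap.comp, translation, ident]
  · funext i; simp [PolyMap.comp, translation, ident]
  · rw [linear_comp_linear, Units.mul_inv, linear_one]
  · rw [linear_comp_linear, Units.inv_mul, linear_one]

theorem IsElementary.isInvertible {F : PolyMap n K} (hF : IsElementary F) : IsInvertible F := by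
  obtain ⟨i, q, hi, rfl⟩ := hF
  have hinv : ∀ r, bind₁ (Function.update (ident n K) i r) q = q := by
    intro r
    have h1 := bind₁_congr_of_notMem_vars (F := Function.update (ident n K) i r)
      (G := ident n K) hi fun k hk => Function.update_of_ne hk _ _
    rw [h1]
    exact bind₁_ident q
  refine ⟨Function.update (ident n K) i (X i - q), ?_, ?_⟩ <;>
  · funext k
    by_cases hk : k = i
    · subst hk
      simp [PolyMap.comp, hinv, ident]
    · simp [PolyMap.comp, hk, ident]

theorem IsTame.isInvertible {F : PolyMap n K} (hF : IsTame F) : IsInvertible F := by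
  induction hF with
  | affine h => exact h.isInvertible
  | elementary h => exact h.isInvertible
  | comp _ _ h1 h2 => exact h1.comp h2

/-! ### Decomposition of `x + h(p)` into shears -/

/-- The map `x + ∑ₖ pᵏ vₖ` is tame when `p` is constant in the directions `vₖ`, `k ≥ 2`, and has
derivative `c - 1` in the direction `v₁`. -/
theorem isTame_add_sum_pow [CharZero K] {p : MvPolynomial (Fin n) K} {v : ℕ → Fin n → K} {c : K}
    (hc : c ≠ 0) (h1 : dirDeriv (v 1) p = C (c - 1)) (h2 : ∀ k, dirDeriv (v (k + 2)) p = 0)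
    (N : ℕ) :
    IsTame (fun i => X i + ∑ k ∈ Finset.range (N + 2), C (v k i) * p ^ k) := by
  induction N with
  | zero =>
    have h : (fun i => X i + ∑ k ∈ Finset.range 2, C (v k i) * p ^ k) =
        (translation (v 0)).comp (shear (v 1) p) := by
      funext i
      simp [comp, translation, shear, Finset.sum_range_succ]
      ring
    rw [h]
    exact .comp (.affine (isAffine_translation _)) (isTame_shear_of_dirDeriv_eq_C hc h1)
  | succ N ih =>
    have h : (fun i => X i + ∑ k ∈ Finset.range (N + 1 + 2), C (v k i) * p ^ k) =
        PolyMap.comp (fun i => X i + ∑ k ∈ Finset.range (N + 2), C (v k i) * p ^ k)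
          (shear (v (N + 2)) (p ^ (N + 2))) := by
      funext i
      rw [comp, map_add, map_sum, bind₁_X_right]
      simp only [map_mul, map_pow, bind₁_C_right, bind₁_shear_of_dirDeriv_eq_zero (h2 N)]
      rw [show N + 1 + 2 = (N + 2) + 1 from rfl, Finset.sum_range_succ, shear]
      ring
    rw [h]
    refine .comp ih (isTame_shear ?_)
    rw [Derivation.leibniz_pow, h2, smul_zero, smul_zero]

/-- The identity of `sum_derivative_mul_pderiv`, coefficient by coefficient. -/
theorem dirDeriv_coeff [CharZero K] {p : MvPolynomial (Fin n) K} {h : Fin n → Polynomial K} {c : K}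
    (hsum : ∑ i, (Polynomial.derivative (h i)).map C * Polynomial.C (pderiv i p) =
      Polynomial.C (C (c - 1))) (k : ℕ) :
    dirDeriv (fun i => (h i).coeff (k + 1)) p = if k = 0 then C (c - 1) else 0 := by
  have h1 := congrArg (fun E => Polynomial.coeff E k) hsum
  simp only [Polynomial.finsetSum_coeff, Polynomial.coeff_mul_C, Polynomial.coeff_map,
    Polynomial.coeff_derivative, Polynomial.coeff_C] at h1
  rw [dirDeriv_apply]
  have hk : (C ((k : K) + 1) : MvPolynomial (Fin n) K) ≠ 0 := by
    rw [Ne, C_eq_zero]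
    exact Nat.cast_add_one_ne_zero k
  apply mul_left_cancel₀ hk
  rw [Finset.mul_sum]
  refine Eq.trans (Finset.sum_congr rfl fun i _ => ?_) (h1.trans ?_)
  · rw [C_mul]; ring
  · split_ifs with h0
    · simp [h0]
    · rw [mul_zero]

theorem isTame_ident_add_aeval [CharZero K] {p : MvPolynomial (Fin n) K} {h : Fin n → Polynomial K}
    {c : K} (hc : c ≠ 0)
    (hsum : ∑ i, (Polynomial.derivative (h i)).map C * Polynomial.C (pderiv i p) =
      Polynomial.C (C (c - 1))) :
    IsTame (ident n K + fun i => Polynomial.aeval p (h i)) := by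
  let N := ∑ i, (h i).natDegree
  have hF : (ident n K + fun i => Polynomial.aeval p (h i)) =
      fun i => X i + ∑ k ∈ Finset.range (N + 2), C ((h i).coeff k) * p ^ k := by
    funext i
    rw [Pi.add_apply, ident, Polynomial.aeval_eq_sum_range' (n := N + 2)]
    · simp only [smul_eq_C_mul]
    · have := Finset.single_le_sum (f := fun i => (h i).natDegree) (fun _ _ => Nat.zero_le _)
        (Finset.mem_univ i)
      exact lt_of_le_of_lt this (by simp [N])
  rw [hF]
  exact isTame_add_sum_pow (v := fun k i => (h i).coeff k) hc (by simpa using dirDeriv_coeff hsum 0)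
    (fun k => by simpa using dirDeriv_coeff hsum (k + 1)) N

/-- If `∑ⱼ hⱼ'(t) ∂ⱼ p = 0` for an independent variable `t`, put `t = p(y)`. -/
theorem jacobianProductVanishes_aeval {p : MvPolynomial (Fin n) K} {h : Fin n → Polynomial K}
    (hsum : ∑ i, (Polynomial.derivative (h i)).map C * Polynomial.C (pderiv i p) = 0) :
    JacobianProductVanishes (fun i => Polynomial.aeval p (h i)) := by
  let ρ : MvPolynomial (Fin n) K →ₐ[K] MvPolynomial (Fin n ⊕ Fin n) K := rename Sum.inl
  let τ : MvPolynomial (Fin n) K →ₐ[K] MvPolynomial (Fin n ⊕ Fin n) K := rename Sum.inr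
  have h1 := congrArg (Polynomial.eval₂ (ρ : _ →+* _) (τ p)) hsum
  have h2 : ∀ f : Polynomial K,
      (f.map C).eval₂ (ρ : MvPolynomial (Fin n) K →+* _) (τ p) = τ (Polynomial.aeval p f) := by
    intro f
    rw [Polynomial.eval₂_map, ← Polynomial.aeval_algHom_apply, Polynomial.aeval_def]
    congr 1
    ext a
    simp [ρ, algebraMap_eq]
  simp only [Polynomial.eval₂_finsetSum, Polynomial.eval₂_mul, h2, Polynomial.eval₂_C,
    Polynomial.eval₂_zero] at h1
  ext1 i k
  rw [Matrix.mul_apply, Matrix.zero_apply]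
  simp only [Matrix.map_apply, jacobian, Matrix.of_apply, pderiv_aeval]
  change ∑ j, ρ _ * τ _ = 0
  simp only [map_mul]
  rw [← mul_zero (ρ (Polynomial.aeval p (Polynomial.derivative (h i))) * τ (pderiv k p)), ← h1,
    Finset.mul_sum]
  refine Finset.sum_congr rfl fun j _ => ?_
  change _ = _ * (_ * ρ (pderiv j p))
  ring

theorem det_jacobian_eq_one_of_noLinearTerms {H : PolyMap n K} (hH : NoLinearTerms H)
    (hKeller : IsKeller (ident n K + H)) : (jacobian (ident n K + H)).det = 1 := by
  obtain ⟨c, -, hc⟩ := hKeller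
  have h0 : (jacobian H).map (constantCoeff : MvPolynomial (Fin n) K →+* K) = 0 := by
    ext1 i j
    rw [Matrix.map_apply, jacobian, Matrix.of_apply, constantCoeff_eq, coeff_pderiv, zero_add, hH,
      zero_mul, Matrix.zero_apply]
  have h1 := congrArg (constantCoeff : MvPolynomial (Fin n) K →+* K) hc
  rw [RingHom.map_det, jacobian_ident_add, map_add, map_one, RingHom.mapMatrix_apply, h0, add_zero,
    Matrix.det_one, constantCoeff_C] at h1
  rw [hc, ← h1, C_1]

end PolyMap

theorem mainTheorem5 {K : Type*} [Field K] [CharZero K] {n : ℕ} (H : PolyMap n K)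
    (hKeller : PolyMap.IsKeller (PolyMap.ident n K + H))
    (hrank : PolyMap.polyRank (PolyMap.jacobian H) = 1) :
    PolyMap.IsInvertible (PolyMap.ident n K + H) ∧
    PolyMap.IsTame (PolyMap.ident n K + H) ∧
    (PolyMap.NoLinearTerms H → (PolyMap.jacobian (PolyMap.ident n K + H)).det = 1) ∧
    ((PolyMap.jacobian (PolyMap.ident n K + H)).det = 1 →
      PolyMap.JacobianProductVanishes H) := by
  obtain ⟨i₀, j₀, hne⟩ := PolyMap.exists_pderiv_ne_zero_of_polyRank_eq_one hrank
  obtain ⟨p, hp⟩ := MvPolynomial.exists_forall_proportionalGrad_eq_aeval hne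
  choose h hh using fun i => hp (H i) (PolyMap.proportionalGrad_of_polyRank_eq_one hrank i i₀)
  have hH : H = fun i => Polynomial.aeval p (h i) := funext hh
  have hp0 : p.totalDegree ≠ 0 := by
    rw [hh, PolyMap.pderiv_aeval] at hne
    exact MvPolynomial.totalDegree_ne_zero_of_pderiv_ne_zero (right_ne_zero_of_mul hne)
  have htame : PolyMap.IsTame (PolyMap.ident n K + H) := by
    obtain ⟨c, hc, hdet⟩ := hKeller
    rw [hH] at hdet ⊢
    exact PolyMap.isTame_ident_add_aeval hc (PolyMap.sum_derivative_mul_pderiv hp0 hdet)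
  refine ⟨htame.isInvertible, htame,
    fun h1 => PolyMap.det_jacobian_eq_one_of_noLinearTerms h1 hKeller, fun hdet => ?_⟩
  rw [hH] at hdet ⊢
  refine PolyMap.jacobianProductVanishes_aeval ?_
  rw [PolyMap.sum_derivative_mul_pderiv (c := 1) hp0 (by rw [hdet, MvPolynomial.C_1]), sub_self,
    MvPolynomial.C_0, Polynomial.C_0]
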